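/- Theorem ($B_n$ is Hopfian). For an integer $n \ge 0$ let $B_n$ be the braid group on $n$ strings, that is, the group with generators $\sigma_1,\dots,\sigma_{n-1}$ and defining relations $\sigma_i\sigma_j=\sigma_j\sigma_i$ for $|i-j|>1$ and $\sigma_i\sigma_j\sigma_i=\sigma_j\sigma_i\sigma_j$ for $|i-j|=1$ (for $n\le 1$ there are no generators and $B_n$ is trivial). Then $B_n$ is Hopfian: for every normal subgroup $N \ne \{1\}$ of $B_n$, the quotient group $B_n/N$ is not isomorphic to $B_n$. -/

import Mathlib

/-- The relators of the Artin presentation, in the free group on `σ₁, …, σₙ₋₁`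
(indexed from `0` by `Fin (n - 1)`): `σᵢ σⱼ = σⱼ σᵢ` for `|i - j| > 1` and
`σᵢ σⱼ σᵢ = σⱼ σᵢ σⱼ` for `|i - j| = 1`. -/
def braidRels (n : ℕ) : Set (FreeGroup (Fin (n - 1))) :=
  {r | ∃ i j : Fin (n - 1), 1 < |(i : ℤ) - (j : ℤ)| ∧
      r = (FreeGroup.of i * FreeGroup.of j) * (FreeGroup.of j * FreeGroup.of i)⁻¹} ∪
  {r | ∃ i j : Fin (n - 1), |(i : ℤ) - (j : ℤ)| = 1 ∧
      r = (FreeGroup.of i * FreeGroup.of j * FreeGroup.of i) *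
        (FreeGroup.of j * FreeGroup.of i * FreeGroup.of j)⁻¹}

/-- The braid group `Bₙ` on `n` strings, given by the Artin presentation. For `n ≤ 1` there
are no generators and the group is trivial. -/
abbrev BraidGroup (n : ℕ) : Type := PresentedGroup (braidRels n)

/-- A group is Hopfian if it is not isomorphic to its quotient by any nontrivial normal
subgroup. -/
def IsHopfian (G : Type*) [Group G] : Prop :=
  ∀ (N : Subgroup G) [N.Normal], N ≠ ⊥ → IsEmpty (G ≃* G ⧸ N)

/-! A finitely generated residually finite group is Hopfian, so it suffices to separate braids by
finite quotients. Braids act by Hurwitz moves on sequences in a finite group `Q`, and the point is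
that these actions are jointly faithful. Induct on strands. By combing (`exists_normal_form`), a
braid is `u * c * d`: `u` is a word in the pure generators of the last strand, `c` a braid on the
earlier strands, `d` a descending product. Sequences in `ZMod 2` force `d = 1`; sequences trivial at
the last strand do not see `u`, so induction gives `c = 1`; finally `u` conjugates the last
coordinate, and wreath products over finite quotients of a free group detect the conjugator
(`eq_one_of_mem_pure`). Neither uniqueness of the normal form nor freeness of the pure subgroup is
needed beforehand. -/

/-- The braid relations among `s 0, …, s (L - 1)`. -/
structure BraidRelations {G : Type*} [Group G] (s : ℕ → G) (L : ℕ) : Prop where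
  comm : ∀ i j, i + 1 < j → j < L → s i * s j = s j * s i
  braid : ∀ i, i + 1 < L → s i * s (i + 1) * s i = s (i + 1) * s i * s (i + 1)

/-! ### Combing braids -/

namespace BraidRelations

variable {G : Type*} [Group G]

/-- The descending product `s (l - 1) * ⋯ * s (k + 1) * s k`. -/
def desc (s : ℕ → G) (k : ℕ) : ℕ → G
  | 0 => 1
  | l + 1 => if k ≤ l then s l * desc s k l else 1

theorem desc_of_le (s : ℕ → G) {k l : ℕ} (h : l ≤ k) : desc s k l = 1 := by
  cases l with
  | zero => rfl
  | succ l => rw [desc, if_neg (by omega)]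

theorem desc_succ (s : ℕ → G) {k l : ℕ} (h : k ≤ l) : desc s k (l + 1) = s l * desc s k l := by
  rw [desc, if_pos h]

theorem desc_eq_mul (s : ℕ → G) {k l : ℕ} (h : k < l) :
    desc s k l = desc s (k + 1) l * s k := by
  induction l with
  | zero => omega
  | succ l ih =>
    rw [desc_succ s (by omega)]
    rcases Nat.lt_or_ge k l with hk | hk
    · rw [ih hk, desc_succ s (by omega), mul_assoc]
    · obtain rfl : k = l := by omega
      rw [desc_of_le s le_rfl, desc_of_le s le_rfl, mul_one, one_mul]

variable {s : ℕ → G} {L : ℕ}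

theorem commute (hs : BraidRelations s L) {i j : ℕ} (h : i + 1 < j) (hj : j < L) :
    Commute (s i) (s j) := hs.comm i j h hj

theorem commute_desc_of_lt (hs : BraidRelations s L) {j k l : ℕ} (h : j + 1 < k) (hl : l ≤ L) :
    Commute (s j) (desc s k l) := by
  induction l with
  | zero => exact Commute.one_right _
  | succ l ih =>
    rcases Nat.lt_or_ge l k with hk | hk
    · rw [desc_of_le s (by omega)]; exact Commute.one_right _
    · rw [desc_succ s hk]
      exact (hs.commute (by omega) (by omega)).mul_right (ih (by omega))

theorem commute_desc_of_gt (hs : BraidRelations s L) {j k l : ℕ} (h : l < j) (hj : j < L) :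
    Commute (s j) (desc s k l) := by
  induction l with
  | zero => exact Commute.one_right _
  | succ l ih =>
    rcases Nat.lt_or_ge l k with hk | hk
    · rw [desc_of_le s (by omega)]; exact Commute.one_right _
    · rw [desc_succ s hk]
      exact (hs.commute (by omega) (by omega)).symm.mul_right (ih (by omega))

/-- Moving left, `s (j + 1)` commutes past the low factors, becomes `s j` by one braid relation, and
commutes past the rest. -/
theorem desc_mul_shift (hs : BraidRelations s L) {j k l : ℕ} (hk : k ≤ j) (hj : j + 1 < l)
    (hl : l ≤ L) : desc s k l * s (j + 1) = s j * desc s k l := by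
  induction l with
  | zero => omega
  | succ l ih =>
    rw [desc_succ s (by omega)]
    rcases Nat.lt_or_ge (j + 1) l with h | h
    · rw [mul_assoc, ih h (by omega), ← mul_assoc, ← mul_assoc, hs.comm j l h (by omega)]
    · obtain rfl : l = j + 1 := by omega
      rw [desc_succ s hk, mul_assoc, mul_assoc,
        ← (hs.commute_desc_of_gt (Nat.lt_succ_self j) (by omega)).eq]
      simp only [← mul_assoc]
      rw [hs.braid j (by omega)]

/-- The pure braid generator in which the last strand `l` winds around strand `i`. -/
def pureGen (s : ℕ → G) (l i : ℕ) : G := desc s (i + 1) l * (s i * s i) * (desc s (i + 1) l)⁻¹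

theorem commute_pureGen_of_lt (hs : BraidRelations s L) {i j l : ℕ} (h : j + 1 < i) (hi : i < l)
    (hl : l ≤ L) : Commute (s j) (pureGen s l i) := by
  have h1 := hs.commute_desc_of_lt (j := j) (k := i + 1) (by omega) hl
  have h2 := hs.commute h (by omega)
  exact (h1.mul_right (h2.mul_right h2)).mul_right h1.inv_right

theorem commute_pureGen_of_gt (hs : BraidRelations s L) {i j l : ℕ} (h : i < j) (hj : j + 1 < l)
    (hl : l ≤ L) : Commute (s j) (pureGen s l i) := by
  have h1 : desc s (i + 1) l * s (j + 1) = s j * desc s (i + 1) l :=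
    hs.desc_mul_shift (by omega) hj hl
  have h2 : Commute (s (j + 1)) (s i) := (hs.commute (by omega) (by omega)).symm
  have h3 : s j = desc s (i + 1) l * s (j + 1) * (desc s (i + 1) l)⁻¹ := by rw [h1]; group
  rw [h3, pureGen]
  exact (h2.mul_right h2).conj _

theorem conj_pureGen_self (hs : BraidRelations s L) {j l : ℕ} (hj : j + 1 < l) (hl : l ≤ L) :
    s j * pureGen s l j * (s j)⁻¹ = pureGen s l (j + 1) := by
  have h1 := (hs.commute_desc_of_lt (j := j) (k := j + 2) (by omega) hl).eq
  have h2 := hs.braid j (by omega)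
  rw [pureGen, pureGen, desc_eq_mul s hj]
  generalize desc s (j + 1 + 1) l = d at *
  generalize s j = x at *
  generalize s (j + 1) = y at *
  have h3 : x * y * (x * x) = y * y * (x * y) := by
    rw [← mul_assoc, h2, mul_assoc, mul_assoc, mul_assoc, ← mul_assoc x y x, h2]
    simp only [mul_assoc]
  calc x * (d * y * (x * x) * (d * y)⁻¹) * x⁻¹
      = (x * d) * (y * (x * x)) * y⁻¹ * d⁻¹ * x⁻¹ := by group
    _ = d * (x * y * (x * x)) * y⁻¹ * d⁻¹ * x⁻¹ := by rw [h1]; group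
    _ = d * (y * y) * (x * d⁻¹ * x⁻¹) := by rw [h3]; group
    _ = d * (y * y) * d⁻¹ := by
      rw [mul_assoc x, (show Commute x d from h1).inv_inv.symm.eq, mul_inv_cancel_left]

/-- The common factor `d` commutes with `s j`, which leaves the three-strand identity `h4`. -/
theorem conj_pureGen_succ (hs : BraidRelations s L) {j l : ℕ} (hj : j + 1 < l) (hl : l ≤ L) :
    s j * pureGen s l (j + 1) * (s j)⁻¹ =
      (pureGen s l (j + 1))⁻¹ * pureGen s l j * pureGen s l (j + 1) := by
  have h1 := (hs.commute_desc_of_lt (j := j) (k := j + 2) (by omega) hl)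
  have h2 := hs.braid j (by omega)
  rw [pureGen, pureGen, desc_eq_mul s hj]
  generalize desc s (j + 1 + 1) l = d at *
  generalize s j = x at *
  generalize s (j + 1) = y at *
  have h3 : y * x * (y * y) = x * x * (y * x) := by
    rw [← mul_assoc, ← h2, mul_assoc, mul_assoc, mul_assoc, ← mul_assoc y x y, ← h2]
    simp only [mul_assoc]
  have h4 : x * (y * y) * x⁻¹ = y⁻¹ * (x * x) * y := by
    calc x * (y * y) * x⁻¹ = y⁻¹ * (y * x * (y * y)) * x⁻¹ := by group
      _ = _ := by rw [h3]; group
  have h5 : x * d = d * x := h1.eq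
  have h6 : d⁻¹ * x⁻¹ = x⁻¹ * d⁻¹ := h1.symm.inv_inv.eq
  calc x * (d * (y * y) * d⁻¹) * x⁻¹ = (x * d) * (y * y) * (d⁻¹ * x⁻¹) := by group
    _ = d * (x * (y * y) * x⁻¹) * d⁻¹ := by rw [h5, h6]; group
    _ = _ := by rw [h4]; group

/-- The subgroup generated by `s i` for `i < m`. -/
def initial (s : ℕ → G) (m : ℕ) : Subgroup G := Subgroup.closure (s '' Set.Iio m)

/-- The subgroup of pure braids in which only the last strand `l` moves. -/
def pure (s : ℕ → G) (l : ℕ) : Subgroup G := Subgroup.closure (pureGen s l '' Set.Iio l)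

theorem mem_initial {i m : ℕ} (h : i < m) : s i ∈ initial s m :=
  Subgroup.subset_closure ⟨i, h, rfl⟩

theorem pureGen_mem {i l : ℕ} (h : i < l) : pureGen s l i ∈ pure s l :=
  Subgroup.subset_closure ⟨i, h, rfl⟩

theorem mem_normalizer_closure {S : Set G} {g : G}
    (h : ∀ x ∈ S, g * x * g⁻¹ ∈ Subgroup.closure S)
    (h' : ∀ x ∈ S, g⁻¹ * x * g ∈ Subgroup.closure S) :
    g ∈ Subgroup.normalizer (Subgroup.closure S : Set G) := by
  have key : ∀ k : G, (∀ x ∈ S, k * x * k⁻¹ ∈ Subgroup.closure S) →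
      ∀ x ∈ Subgroup.closure S, k * x * k⁻¹ ∈ Subgroup.closure S := by
    intro k hk
    have : Subgroup.closure S ≤ (Subgroup.closure S).comap (MulAut.conj k).toMonoidHom :=
      (Subgroup.closure_le _).2 fun x hx => by simpa using hk x hx
    intro x hx
    simpa using this hx
  rw [Subgroup.mem_normalizer_iff]
  refine fun x => ⟨key g h x, fun hx => ?_⟩
  have := key g⁻¹ (by simpa using h') _ hx
  simpa [mul_assoc] using this

theorem initial_le_normalizer (hs : BraidRelations s L) {m : ℕ} (hm : m + 1 ≤ L) :
    initial s m ≤ Subgroup.normalizer (pure s (m + 1) : Set G) := by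
  refine (Subgroup.closure_le _).2 ?_
  rintro _ ⟨j, hj, rfl⟩
  have hj : j < m := hj
  refine mem_normalizer_closure ?_ ?_
  all_goals
    rintro _ ⟨i, hi, rfl⟩
    have hi : i < m + 1 := hi
    change _ ∈ pure s (m + 1)
    have ai := pureGen_mem (s := s) hi
    have aj := pureGen_mem (s := s) (show j < m + 1 by omega)
    have aj' := pureGen_mem (s := s) (show j + 1 < m + 1 by omega)
    have e0 := hs.conj_pureGen_self (j := j) (l := m + 1) (by omega) hm
    have e1 := hs.conj_pureGen_succ (j := j) (l := m + 1) (by omega) hm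
    rcases Nat.lt_trichotomy i j with h | rfl | h
    · have e := hs.commute_pureGen_of_gt h (show j + 1 < m + 1 by omega) hm
      first
      | rw [e.eq, mul_inv_cancel_right]; exact ai
      | rw [mul_assoc, ← e.eq, inv_mul_cancel_left]; exact ai
    · first
      | rw [e0]; exact aj'
      | have e2 : (s i)⁻¹ * pureGen s (m + 1) i * s i =
            pureGen s (m + 1) i * pureGen s (m + 1) (i + 1) * (pureGen s (m + 1) i)⁻¹ := by
          have e3 : pureGen s (m + 1) i =
              pureGen s (m + 1) (i + 1) * (s i * pureGen s (m + 1) (i + 1) * (s i)⁻¹) *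
                (pureGen s (m + 1) (i + 1))⁻¹ := by rw [e1]; group
          calc _ = (s i)⁻¹ * (pureGen s (m + 1) (i + 1) *
                (s i * pureGen s (m + 1) (i + 1) * (s i)⁻¹) *
                (pureGen s (m + 1) (i + 1))⁻¹) * s i := by rw [← e3]
            _ = _ := by rw [← e0]; group
        rw [e2]
        exact mul_mem (mul_mem aj aj') (inv_mem aj)
    · rcases Nat.lt_or_ge (j + 1) i with h' | h'
      · have e := hs.commute_pureGen_of_lt h' hi hm
        first
        | rw [e.eq, mul_inv_cancel_right]; exact ai
        | rw [mul_assoc, ← e.eq, inv_mul_cancel_left]; exact ai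
      · obtain rfl : i = j + 1 := by omega
        first
        | rw [e1]; exact mul_mem (mul_mem (inv_mem aj') aj) aj'
        | rw [← e0]; simpa [mul_assoc] using aj

theorem conj_mem_pure (hs : BraidRelations s L) {m : ℕ} (hm : m + 1 ≤ L) {c a : G}
    (hc : c ∈ initial s m) (ha : a ∈ pure s (m + 1)) : c * a * c⁻¹ ∈ pure s (m + 1) :=
  (Subgroup.mem_normalizer_iff.1 (hs.initial_le_normalizer hm hc) a).1 ha

/-- Such products are stable under right multiplication by `s j` and its inverse: the letter passes
into `c` or changes `k` by one, and any pure generator this creates is carried past `c` into `u` by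
normality. -/
theorem exists_normal_form (hs : BraidRelations s L) {m : ℕ} (hm : m + 1 ≤ L) {b : G}
    (hb : b ∈ initial s (m + 1)) :
    ∃ u ∈ pure s (m + 1), ∃ c ∈ initial s m, ∃ k ≤ m + 1, b = u * c * desc s k (m + 1) := by
  have absorb : ∀ {u c a d : G} {k : ℕ}, u ∈ pure s (m + 1) → c ∈ initial s m →
      a ∈ pure s (m + 1) → k ≤ m + 1 → d = a * desc s k (m + 1) →
      ∃ u' ∈ pure s (m + 1), ∃ c' ∈ initial s m, ∃ k' ≤ m + 1,
        u * c * d = u' * c' * desc s k' (m + 1) := by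
    intro u c a d k hu hc ha hk hd
    refine ⟨u * (c * a * c⁻¹), mul_mem hu (hs.conj_mem_pure hm hc ha), c, hc, k, hk, ?_⟩
    rw [hd]; group
  have swap : ∀ {u c x d : G} {k : ℕ}, u ∈ pure s (m + 1) → c ∈ initial s m →
      x ∈ initial s m → k ≤ m + 1 → d = x * desc s k (m + 1) →
      ∃ u' ∈ pure s (m + 1), ∃ c' ∈ initial s m, ∃ k' ≤ m + 1,
        u * c * d = u' * c' * desc s k' (m + 1) := by
    intro u c x d k hu hc hx hk hd
    refine ⟨u, hu, c * x, mul_mem hc hx, k, hk, ?_⟩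
    rw [hd]; group
  induction hb using Subgroup.closure_induction_right with
  | one => exact ⟨1, one_mem _, 1, one_mem _, m + 1, le_rfl, by simp [desc_of_le]⟩
  | mul_right x hx y hy ih =>
    obtain ⟨j, hj, rfl⟩ := hy
    have hj : j < m + 1 := hj
    obtain ⟨u, hu, c, hc, k, hk, rfl⟩ := ih
    rw [mul_assoc]
    rcases Nat.lt_trichotomy j k with h | rfl | h
    · rcases Nat.lt_or_ge (j + 1) k with h' | h'
      · exact swap hu hc (mem_initial (show j < m by omega)) hk
          (hs.commute_desc_of_lt h' hm).symm.eq
      · obtain rfl : k = j + 1 := by omega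
        exact swap hu hc (one_mem _) (show j ≤ m + 1 by omega) (by rw [desc_eq_mul s hj, one_mul])
    · refine absorb hu hc (pureGen_mem hj) (show j + 1 ≤ m + 1 by omega) ?_
      rw [desc_eq_mul s hj, pureGen]; group
    · obtain ⟨i, rfl⟩ : ∃ i, j = i + 1 := ⟨j - 1, by omega⟩
      exact swap hu hc (mem_initial (show i < m by omega)) hk
        (hs.desc_mul_shift (by omega) hj hm)
  | mul_inv_cancel x hx y hy ih =>
    obtain ⟨j, hj, rfl⟩ := hy
    have hj : j < m + 1 := hj
    obtain ⟨u, hu, c, hc, k, hk, rfl⟩ := ih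
    rw [mul_assoc]
    rcases Nat.lt_trichotomy j k with h | rfl | h
    · rcases Nat.lt_or_ge (j + 1) k with h' | h'
      · exact swap hu hc (inv_mem (mem_initial (show j < m by omega))) hk
          (hs.commute_desc_of_lt h' hm).inv_left.symm.eq
      · obtain rfl : k = j + 1 := by omega
        refine absorb hu hc (inv_mem (pureGen_mem hj)) (show j ≤ m + 1 by omega) ?_
        rw [desc_eq_mul s hj, pureGen]; group
    · exact swap hu hc (one_mem _) (show j + 1 ≤ m + 1 by omega)
        (by rw [desc_eq_mul s hj, one_mul, mul_inv_cancel_right])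
    · obtain ⟨i, rfl⟩ : ∃ i, j = i + 1 := ⟨j - 1, by omega⟩
      refine swap hu hc (inv_mem (mem_initial (show i < m by omega))) hk ?_
      rw [mul_inv_eq_iff_eq_mul, mul_assoc, hs.desc_mul_shift (by omega) hj hm,
        inv_mul_cancel_left]

end BraidRelations


-- Residual finiteness and the Hopf property

universe u

/-- Free groups are residually finite. -/
theorem FreeGroup.exists_finite_monoidHom_ne_one {α : Type u} {w : FreeGroup α} (hw : w ≠ 1) :
    ∃ (X : Type u) (_ : Finite X) (f : FreeGroup α →* Equiv.Perm X), f w ≠ 1 := by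
  classical
  -- On the finite set of suffixes of the reduced word, left multiplication by a generator is a
  -- partial injection, so it extends to a permutation. The word `w` then carries `1` through its
  -- suffixes to `w`.
  let X : Set (FreeGroup α) := FreeGroup.mk '' {v | v ∈ w.toWord.tails}
  have hX : Finite X := (List.finite_toSet _).image _
  have ext (a : α) : ∃ p : Equiv.Perm X, ∀ x : {x : X // of a * (x : FreeGroup α) ∈ X},
      p x = ⟨of a * (x : FreeGroup α), x.2⟩ :=
    Equiv.Perm.exists_extending_pair (fun x : {x : X // of a * (x : FreeGroup α) ∈ X} => (x : X))
      (fun x => ⟨of a * (x : FreeGroup α), x.2⟩) Subtype.val_injective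
      (fun x y h => Subtype.ext (Subtype.ext (mul_left_cancel (Subtype.ext_iff.1 h))))
  choose p hp using ext
  have mem (v : List (α × Bool)) (hv : v <:+ w.toWord) : FreeGroup.mk v ∈ X :=
    ⟨v, (List.mem_tails _ _).2 hv, rfl⟩
  have main : ∀ v (_ : v <:+ w.toWord),
      (lift p (FreeGroup.mk v) ⟨FreeGroup.mk [], mem [] List.nil_suffix⟩ : FreeGroup α) =
        FreeGroup.mk v := by
    intro v
    induction v with
    | nil => exact fun _ => congrArg Subtype.val (DFunLike.congr_fun (_root_.map_one (lift p)) _)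
    | cons x v ih =>
      intro hv
      have hv' : v <:+ w.toWord := (List.suffix_cons x v).trans hv
      have hx : FreeGroup.mk (x :: v) = FreeGroup.mk [x] * FreeGroup.mk v := by simp
      have h := mem _ hv
      replace ih := Subtype.ext (a2 := ⟨_, mem v hv'⟩) (ih hv')
      rw [hx] at h ⊢
      rw [_root_.map_mul, Equiv.Perm.mul_apply, ih]
      obtain ⟨a, _ | _⟩ := x
      · have e : FreeGroup.mk [(a, false)] = (of a)⁻¹ := rfl
        rw [e] at h ⊢
        have h1 := hp a ⟨⟨(of a)⁻¹ * FreeGroup.mk v, h⟩, by simpa using mem v hv'⟩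
        simp only [mul_inv_cancel_left] at h1
        rw [_root_.map_inv, lift_apply_of, ← h1]
        exact congrArg Subtype.val (Equiv.symm_apply_apply (p a) _)
      · have e : FreeGroup.mk [(a, true)] = of a := rfl
        rw [e] at h ⊢
        rw [lift_apply_of, hp a ⟨⟨FreeGroup.mk v, mem v hv'⟩, h⟩]
  refine ⟨X, hX, lift p, fun h => hw ?_⟩
  have := main w.toWord List.suffix_rfl
  rw [mk_toWord, h] at this
  exact this.symm

/-- A group is Hopfian if its elements are separated by homomorphisms to groups `P` for which
`G →* P` is finite. -/
theorem isHopfian_of_exists_monoidHom_ne_one {G : Type*} [Group G]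
    (hG : ∀ g : G, g ≠ 1 → ∃ (P : Type) (_ : Group P) (_ : Finite (G →* P)) (f : G →* P), f g ≠ 1) :
    IsHopfian G := by
  intro N _ hN
  refine ⟨fun e => hN ((Subgroup.eq_bot_iff_forall _).2 fun g hg => ?_)⟩
  by_contra hne
  obtain ⟨P, _, _, f, hf⟩ := hG g hne
  let φ : G →* G := e.symm.toMonoidHom.comp (QuotientGroup.mk' N)
  have hφ : Function.Surjective φ :=
    e.symm.surjective.comp (QuotientGroup.mk'_surjective N)
  -- An injective self-map of a finite set is onto, so `f` factors through `φ` and kills `N`.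
  have inj : Function.Injective fun ψ : G →* P => ψ.comp φ :=
    fun ψ₁ ψ₂ h => (MonoidHom.cancel_right hφ).1 h
  obtain ⟨ψ, rfl⟩ := Finite.surjective_of_injective inj f
  apply hf
  have : (g : G ⧸ N) = 1 := (QuotientGroup.eq_one_iff g).2 hg
  simp [φ, this]


/-! ### Hurwitz action -/

/-- The Hurwitz move `(x, y) ↦ (x * y * x⁻¹, x)` on coordinates `i` and `i + 1` of a sequence in a
group. -/
def hurwitzPerm {Q : Type*} [Group Q] (i : ℕ) : Equiv.Perm (ℕ → Q) where
  toFun q j := if j = i then q i * q (i + 1) * (q i)⁻¹ else if j = i + 1 then q i else q j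
  invFun q j := if j = i then q (i + 1)
    else if j = i + 1 then (q (i + 1))⁻¹ * q i * q (i + 1) else q j
  left_inv q := by
    funext j
    by_cases h : j = i
    · subst h; simp
    · by_cases h' : j = i + 1
      · subst h'; simp [mul_assoc]
      · simp [h, h']
  right_inv q := by
    funext j
    by_cases h : j = i
    · subst h; simp [mul_assoc]
    · by_cases h' : j = i + 1
      · subst h'; simp
      · simp [h, h']

theorem hurwitzPerm_apply {Q : Type*} [Group Q] (i : ℕ) (q : ℕ → Q) (j : ℕ) :
    hurwitzPerm i q j =
      if j = i then q i * q (i + 1) * (q i)⁻¹ else if j = i + 1 then q i else q j := rfl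

theorem hurwitzPerm_comm {Q : Type*} [Group Q] {i j : ℕ} (h : i + 1 < j) :
    (hurwitzPerm i * hurwitzPerm j : Equiv.Perm (ℕ → Q)) = hurwitzPerm j * hurwitzPerm i := by
  ext q k
  simp only [Equiv.Perm.mul_apply, hurwitzPerm_apply]
  rw [if_neg (show i ≠ j by omega), if_neg (show i ≠ j + 1 by omega),
    if_neg (show i + 1 ≠ j by omega), if_neg (show i + 1 ≠ j + 1 by omega),
    if_neg (show j ≠ i by omega), if_neg (show j ≠ i + 1 by omega),
    if_neg (show j + 1 ≠ i by omega), if_neg (show j + 1 ≠ i + 1 by omega)]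
  split_ifs <;> first | rfl | omega

theorem hurwitzPerm_braid {Q : Type*} [Group Q] (i : ℕ) :
    (hurwitzPerm i * hurwitzPerm (i + 1) * hurwitzPerm i : Equiv.Perm (ℕ → Q)) =
      hurwitzPerm (i + 1) * hurwitzPerm i * hurwitzPerm (i + 1) := by
  ext q k
  simp only [Equiv.Perm.mul_apply, hurwitzPerm_apply]
  have h1 (i : ℕ) : i ≠ i + 1 + 1 := by omega
  have h2 (i : ℕ) : i + 1 + 1 ≠ i := by omega
  by_cases h : k = i
  · subst h; simp [mul_assoc, h1, h2]
  · by_cases h' : k = i + 1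
    · subst h'; simp [h1, h2]
    · by_cases h'' : k = i + 1 + 1
      · subst h''; simp [h1, h2]
      · simp [h, h', h'']

namespace BraidGroup

open BraidRelations

variable {n : ℕ}

theorem braidRels_lift_eq_one {G : Type*} [Group G] {s : ℕ → G} {n : ℕ}
    (hs : BraidRelations s (n - 1)) :
    ∀ r ∈ braidRels n, FreeGroup.lift (fun i : Fin (n - 1) => s i) r = 1 := by
  rintro r (⟨i, j, h, rfl⟩ | ⟨i, j, h, rfl⟩)
  · simp only [map_mul, map_inv, FreeGroup.lift_apply_of]
    rw [mul_inv_eq_one]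
    rcases lt_abs.1 h with h | h
    · exact (hs.comm j i (by omega) i.2).symm
    · exact hs.comm i j (by omega) j.2
  · simp only [map_mul, map_inv, FreeGroup.lift_apply_of]
    rw [mul_inv_eq_one]
    rcases (abs_eq zero_le_one).1 h with h | h
    · have : (i : ℕ) = j + 1 := by omega
      rw [this]
      exact (hs.braid j (by omega)).symm
    · have : (j : ℕ) = i + 1 := by omega
      rw [this]
      exact hs.braid i (by omega)

/-- The Hurwitz action of the braid group on sequences in a group. -/
def hurwitz (n : ℕ) (Q : Type*) [Group Q] : BraidGroup n →* Equiv.Perm (ℕ → Q) :=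
  PresentedGroup.toGroup (f := fun i : Fin (n - 1) => hurwitzPerm (i : ℕ))
    (braidRels_lift_eq_one
      ⟨fun _ _ h _ => hurwitzPerm_comm h, fun i _ => hurwitzPerm_braid i⟩)

/-- The Artin generators indexed by natural numbers. -/
def gen (n : ℕ) (i : ℕ) : BraidGroup n :=
  if h : i < n - 1 then PresentedGroup.of ⟨i, h⟩ else 1

theorem gen_of_lt {i : ℕ} (h : i < n - 1) : gen n i = PresentedGroup.of ⟨i, h⟩ := dif_pos h

theorem hurwitz_gen {Q : Type*} [Group Q] {i : ℕ} (h : i < n - 1) :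
    hurwitz n Q (gen n i) = hurwitzPerm i := by
  rw [gen_of_lt h]
  exact PresentedGroup.toGroup.of _

theorem braidRelations_gen (n : ℕ) : BraidRelations (gen n) (n - 1) where
  comm i j h hj := by
    rw [gen_of_lt hj, gen_of_lt (show i < n - 1 by omega)]
    refine PresentedGroup.mk_eq_mk_of_mul_inv_mem (Or.inl ⟨_, _, ?_, rfl⟩)
    refine lt_abs.2 (Or.inr ?_)
    simp only
    omega
  braid i h := by
    rw [gen_of_lt h, gen_of_lt (show i < n - 1 by omega)]
    refine PresentedGroup.mk_eq_mk_of_mul_inv_mem (Or.inr ⟨_, _, ?_, rfl⟩)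
    simp

theorem mem_initial_top (b : BraidGroup n) : b ∈ initial (gen n) (n - 1) :=
  PresentedGroup.generated_by _ _ (fun j => by
    have := mem_initial (s := gen n) j.2
    rwa [gen_of_lt j.2] at this) b

section Action

variable {Q R : Type*} [Group Q] [Group R]

theorem hurwitz_desc {k l : ℕ} (hk : k ≤ l) (hl : l ≤ n - 1) (q : ℕ → Q) (j : ℕ) :
    hurwitz n Q (desc (gen n) k l) q j =
      if j < k then q j else if j < l then q k * q (j + 1) * (q k)⁻¹
      else if j = l then q k else q j := by
  induction l, hk using Nat.le_induction generalizing j with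
  | base =>
    rw [desc_of_le _ le_rfl, map_one, Equiv.Perm.one_apply]
    split_ifs with h1 h2 <;> first | rfl | (subst h2; rfl)
  | succ l hk ih =>
    rw [desc_succ _ hk, map_mul, Equiv.Perm.mul_apply, hurwitz_gen (by omega), hurwitzPerm_apply]
    simp only [ih (by omega)]
    rcases Nat.lt_trichotomy j l with h | rfl | h
    · rw [if_neg (show j ≠ l by omega), if_neg (show j ≠ l + 1 by omega), if_pos h,
        if_pos (show j < l + 1 by omega)]
    · simp [show ¬ j < k by omega, show ¬ j + 1 < k by omega]
    · rcases Nat.lt_or_ge (l + 1) j with h' | h'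
      · simp [show ¬ j < l by omega, show j ≠ l by omega, show j ≠ l + 1 by omega,
          show ¬ j < l + 1 by omega]
      · obtain rfl : j = l + 1 := by omega
        simp [show ¬ l < k by omega, show ¬ l + 1 < k by omega]

theorem hurwitz_pureGen {i l : ℕ} (hi : i < l) (hl : l ≤ n - 1) (q : ℕ → Q) :
    ∃ p : ℕ → Q, q = hurwitz n Q (desc (gen n) (i + 1) l) p ∧
      hurwitz n Q (pureGen (gen n) l i) q =
        hurwitz n Q (desc (gen n) (i + 1) l) (hurwitzPerm i (hurwitzPerm i p)) := by
  refine ⟨(hurwitz n Q (desc (gen n) (i + 1) l)).symm q, by simp, ?_⟩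
  rw [pureGen, map_mul, map_mul, map_mul, map_inv, hurwitz_gen (by omega)]
  rfl

theorem hurwitz_pureGen_last {i l : ℕ} (hi : i < l) (hl : l ≤ n - 1) (q : ℕ → Q) :
    hurwitz n Q (pureGen (gen n) l i) q l = q i * q l * (q i)⁻¹ := by
  obtain ⟨p, rfl, h⟩ := hurwitz_pureGen hi hl q
  rw [h]
  simp only [hurwitz_desc (show i + 1 ≤ l by omega) hl]
  simp [hurwitzPerm_apply, show ¬ l < i + 1 by omega]

/-- In the coordinates `p` the generator is two Hurwitz moves, and these send `(x, 1)` to `(1, x)`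
and back. -/
theorem hurwitz_pureGen_of_last_eq_one {i l : ℕ} (hi : i < l) (hl : l ≤ n - 1) {q : ℕ → Q}
    (hq : q l = 1) : hurwitz n Q (pureGen (gen n) l i) q = q := by
  obtain ⟨p, rfl, h⟩ := hurwitz_pureGen hi hl q
  rw [h]
  congr 1
  have hp : p (i + 1) = 1 := by
    simpa [hurwitz_desc (show i + 1 ≤ l by omega) hl, show ¬ l < i + 1 by omega] using hq
  funext j
  simp only [hurwitzPerm_apply]
  by_cases h : j = i
  · subst h; simp [hp]
  · by_cases h' : j = i + 1
    · subst h'; simp [hp]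
    · simp [h, h']

theorem hurwitz_comp (r : Q →* R) (b : BraidGroup n) (q : ℕ → Q) :
    r ∘ hurwitz n Q b q = hurwitz n R b (r ∘ q) := by
  have hb := mem_initial_top b
  have key : ∀ i < n - 1, ∀ q : ℕ → Q,
      r ∘ hurwitz n Q (gen n i) q = hurwitz n R (gen n i) (r ∘ q) := by
    intro i hi q
    rw [hurwitz_gen hi, hurwitz_gen hi]
    funext j
    simp only [Function.comp_apply, hurwitzPerm_apply, apply_ite r, map_mul, map_inv]
  induction hb using Subgroup.closure_induction generalizing q with
  | mem x hx => obtain ⟨i, hi, rfl⟩ := hx; exact key i hi q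
  | one => simp
  | mul x y _ _ ihx ihy => rw [map_mul, map_mul, Equiv.Perm.mul_apply, ihx, ihy]; rfl
  | inv x _ ih =>
    rw [map_inv, map_inv, Equiv.Perm.eq_inv_iff_eq, ← ih]
    exact congrArg _ (Equiv.apply_symm_apply _ _)

theorem hurwitz_initial_of_gt {m j : ℕ} (hm : m ≤ n - 1) (hj : m < j) {b : BraidGroup n}
    (hb : b ∈ initial (gen n) m) (q : ℕ → Q) : hurwitz n Q b q j = q j := by
  induction hb using Subgroup.closure_induction generalizing q with
  | mem x hx =>
    obtain ⟨i, hi, rfl⟩ := hx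
    have hi : i < m := hi
    rw [hurwitz_gen (by omega), hurwitzPerm_apply, if_neg (by omega), if_neg (by omega)]
  | one => simp
  | mul x y _ _ ihx ihy => rw [map_mul, Equiv.Perm.mul_apply, ihx, ihy]
  | inv x _ ih =>
    rw [← ih (hurwitz n Q x⁻¹ q), map_inv]
    exact congrFun (Equiv.apply_symm_apply _ _) j

theorem hurwitz_pure_of_last_eq_one {l : ℕ} (hl : l ≤ n - 1) {u : BraidGroup n}
    (hu : u ∈ pure (gen n) l) {q : ℕ → Q} (hq : q l = 1) : hurwitz n Q u q = q := by
  have : pure (gen n) l ≤ (MulAction.stabilizer (Equiv.Perm (ℕ → Q)) q).comap (hurwitz n Q) := by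
    refine (Subgroup.closure_le _).2 ?_
    rintro _ ⟨i, hi, rfl⟩
    exact hurwitz_pureGen_of_last_eq_one hi hl hq
  exact this hu

/-- Each letter conjugates the last coordinate by a current entry. Earlier letters may have altered
that entry, but not its image under `r`, since pure braids fix `r ∘ q`. -/
theorem hurwitz_lift_last {l : ℕ} (hl : l ≤ n - 1) (r : Q →* R) (w : FreeGroup (Fin l))
    (q : ℕ → Q) (hq : r (q l) = 1) :
    ∃ W : Q, hurwitz n Q (FreeGroup.lift (fun i : Fin l => pureGen (gen n) l i) w) q l =
      W * q l * W⁻¹ ∧ r W = FreeGroup.lift (fun i : Fin l => r (q i)) w := by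
  have hmem : ∀ w, FreeGroup.lift (fun i : Fin l => pureGen (gen n) l i) w ∈ pure (gen n) l := by
    intro w
    have : (FreeGroup.lift fun i : Fin l => pureGen (gen n) l i).range ≤ pure (gen n) l :=
      FreeGroup.range_lift_le (by rintro _ ⟨i, rfl⟩; exact pureGen_mem i.2)
    exact this ⟨w, rfl⟩
  have inv : ∀ u ∈ pure (gen n) l, ∀ q : ℕ → Q, r (q l) = 1 →
      ∀ j, r (hurwitz n Q u q j) = r (q j) := by
    intro u hu q hq j
    have := congrFun (hurwitz_comp r u q) j
    rwa [hurwitz_pure_of_last_eq_one hl hu (show (r ∘ q) l = 1 from hq)] at this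
  induction w using FreeGroup.induction_on generalizing q with
  | C1 => exact ⟨1, by simp, by simp⟩
  | of i => exact ⟨q i, by rw [FreeGroup.lift_apply_of, hurwitz_pureGen_last i.2 hl], by simp⟩
  | inv_of i ih =>
    set a := FreeGroup.lift (fun i : Fin l => pureGen (gen n) l i) (FreeGroup.of i) with ha
    have hA := inv a⁻¹ (inv_mem (hmem _)) q hq
    obtain ⟨W, h1, h2⟩ := ih (hurwitz n Q a⁻¹ q) (by rw [hA, hq])
    refine ⟨W⁻¹, ?_, ?_⟩
    · have : hurwitz n Q a (hurwitz n Q a⁻¹ q) = q := by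
        rw [map_inv]; exact Equiv.apply_symm_apply _ _
      rw [this] at h1
      rw [map_inv, ← ha, h1]; group
    · simp only [hA] at h2
      rw [map_inv, map_inv, h2]
  | mul x y ihx ihy =>
    set b := FreeGroup.lift (fun i : Fin l => pureGen (gen n) l i) y with hb
    have hA := inv b (hmem _) q hq
    obtain ⟨W, h1, h2⟩ := ihy q hq
    obtain ⟨V, h3, h4⟩ := ihx (hurwitz n Q b q) (by rw [hA, hq])
    simp only [hA] at h4
    refine ⟨V * W, ?_, by rw [map_mul, map_mul, h2, h4]⟩
    rw [map_mul, map_mul, Equiv.Perm.mul_apply, ← hb, h3, h1]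
    group

end Action

/-! ### Joint faithfulness over finite groups -/

/-- Conjugation by `W` translates supports by `W.right`, and translation is free. -/
theorem _root_.RegularWreathProduct.right_eq_one_of_commute {D Q : Type*} [Group D] [Group Q]
    [DecidableEq Q] {z : D} (hz : z ≠ 1) {W : D ≀ᵣ Q}
    (h : W * ⟨Pi.mulSingle 1 z, 1⟩ * W⁻¹ = ⟨Pi.mulSingle 1 z, 1⟩) : W.right = 1 := by
  by_contra hW
  rw [mul_inv_eq_iff_eq_mul] at h
  have := congrFun (congrArg RegularWreathProduct.left h) 1
  simp [Pi.mulSingle_apply, hW] at this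
  exact hz this

theorem exists_pure_lift_eq {l : ℕ} {u : BraidGroup n} (hu : u ∈ pure (gen n) l) :
    ∃ w, FreeGroup.lift (fun i : Fin l => pureGen (gen n) l i) w = u := by
  have : pure (gen n) l ≤ (FreeGroup.lift fun i : Fin l => pureGen (gen n) l i).range := by
    refine (Subgroup.closure_le _).2 ?_
    rintro _ ⟨i, hi, rfl⟩
    exact ⟨FreeGroup.of ⟨i, hi⟩, by simp⟩
  exact this hu

theorem eq_one_of_mem_pure {l : ℕ} (hl : l ≤ n - 1) {u : BraidGroup n} (hu : u ∈ pure (gen n) l)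
    (h : ∀ (Q : Type) [Group Q] [Finite Q] (q : ℕ → Q), (∀ j, l < j → q j = 1) →
      hurwitz n Q u q = q) : u = 1 := by
  classical
  obtain ⟨w, rfl⟩ := exists_pure_lift_eq hu
  by_contra hne
  obtain ⟨X, _, f, hf⟩ := FreeGroup.exists_finite_monoidHom_ne_one
    (w := w) (by rintro rfl; exact hne (map_one _))
  have hz : Multiplicative.ofAdd (1 : ZMod 2) ≠ 1 := by decide
  let t : Multiplicative (ZMod 2) ≀ᵣ Equiv.Perm X := ⟨Pi.mulSingle 1 (.ofAdd 1), 1⟩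
  -- The entries before `l` lift the values of `f`, so the conjugator `W` of the last entry `t` lies
  -- over `f w`; fixing `q` makes `W` commute with `t`.
  let q : ℕ → Multiplicative (ZMod 2) ≀ᵣ Equiv.Perm X := fun j =>
    if h : j < l then RegularWreathProduct.inl (f (FreeGroup.of ⟨j, h⟩)) else
      if j = l then t else 1
  have hql : q l = t := by simp [q]
  obtain ⟨W, h1, h2⟩ := hurwitz_lift_last hl RegularWreathProduct.rightHom w q (by
    rw [hql]; rfl)
  rw [h _ q fun j hj => by simp [q, show ¬ j < l by omega, show j ≠ l by omega], hql] at h1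
  have h3 : (FreeGroup.lift fun i : Fin l => RegularWreathProduct.rightHom (q i)) = f := by
    ext1 i
    simp [q]
  rw [h3] at h2
  exact hf (h2 ▸ RegularWreathProduct.right_eq_one_of_commute hz h1.symm)

theorem eq_one_of_mem_initial {m : ℕ} (hm : m ≤ n - 1) {b : BraidGroup n}
    (hb : b ∈ initial (gen n) m)
    (h : ∀ (Q : Type) [Group Q] [Finite Q] (q : ℕ → Q), (∀ j, m < j → q j = 1) →
      hurwitz n Q b q = q) : b = 1 := by
  induction m generalizing b with
  | zero => simpa [initial] using hb
  | succ m ih =>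
    obtain ⟨u, hu, c, hc, k, hk, rfl⟩ := (braidRelations_gen n).exists_normal_form hm hb
    obtain rfl : k = m + 1 := by
      by_contra hne
      have hz : Multiplicative.ofAdd (1 : ZMod 2) ≠ 1 := by decide
      -- `desc` moves the nontrivial entry from `k` to the last place, where `c` leaves it and `u`
      -- only conjugates it; yet `q` is trivial there if `k ≠ m + 1`.
      let q : ℕ → Multiplicative (ZMod 2) := Pi.mulSingle k (.ofAdd 1)
      obtain ⟨w, rfl⟩ := exists_pure_lift_eq hu
      have h1 := congrFun (h _ q fun j hj => Pi.mulSingle_eq_of_ne (by omega) _) (m + 1)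
      rw [map_mul, map_mul, Equiv.Perm.mul_apply, Equiv.Perm.mul_apply] at h1
      obtain ⟨W, h2, -⟩ := hurwitz_lift_last hm (1 : Multiplicative (ZMod 2) →* Unit) w
        (hurwitz n _ c (hurwitz n _ (desc (gen n) k (m + 1)) q)) rfl
      rw [h1, hurwitz_initial_of_gt (by omega) (Nat.lt_succ_self m) hc, hurwitz_desc hk hm,
        if_neg (by omega), if_neg (by omega), if_pos rfl, mul_inv_cancel_comm] at h2
      simp only [q, Pi.mulSingle_eq_same, Pi.mulSingle_eq_of_ne (Ne.symm hne)] at h2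
      exact hz h2.symm
    rw [desc_of_le _ le_rfl, mul_one] at h ⊢
    obtain rfl : c = 1 := by
      refine ih (by omega) hc fun Q _ _ q hq => ?_
      have h1 := h Q q fun j hj => hq j (by omega)
      rwa [map_mul, Equiv.Perm.mul_apply, hurwitz_pure_of_last_eq_one hm hu] at h1
      rw [hurwitz_initial_of_gt (by omega) (Nat.lt_succ_self m) hc]
      exact hq _ (Nat.lt_succ_self m)
    rw [mul_one] at h ⊢
    exact eq_one_of_mem_pure hm hu h

/-- The Hurwitz action on the finite set of sequences supported on the first `n` coordinates. -/
theorem exists_finite_monoidHom_ne_one (b : BraidGroup n) (hb : b ≠ 1) :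
    ∃ (X : Type) (_ : Finite X) (f : BraidGroup n →* Equiv.Perm X), f b ≠ 1 := by
  have : ∃ (Q : Type) (_ : Group Q) (_ : Finite Q) (q : ℕ → Q),
      (∀ j, n - 1 < j → q j = 1) ∧ hurwitz n Q b q ≠ q := by
    by_contra! h
    exact hb (eq_one_of_mem_initial le_rfl (mem_initial_top b) fun Q _ _ q hq => h Q _ ‹_› q hq)
  obtain ⟨Q, _, _, q, hq, hne⟩ := this
  let : MulAction (BraidGroup n) (ℕ → Q) := MulAction.compHom _ (hurwitz n Q)
  let Y : SubMulAction (BraidGroup n) (ℕ → Q) :=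
    { carrier := {q | ∀ j, n - 1 < j → q j = 1}
      smul_mem' := fun c q hq j hj =>
        (hurwitz_initial_of_gt le_rfl hj (mem_initial_top c) q).trans (hq j hj) }
  have : Finite Y := by
    -- `n - 1 + 1` is `n`, except that it is `1` for `n = 0`.
    refine Finite.of_injective (fun (y : Y) (j : Fin (n - 1 + 1)) => (y : ℕ → Q) j) ?_
    intro y z hyz
    ext j
    rcases Nat.lt_or_ge j (n - 1 + 1) with hj | hj
    · exact congrFun hyz ⟨j, hj⟩
    · rw [y.2 j hj, z.2 j hj]
  refine ⟨Y, this, MulAction.toPermHom _ Y, fun h => hne ?_⟩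
  exact congrArg Subtype.val (DFunLike.congr_fun h (⟨q, hq⟩ : Y))

end BraidGroup

theorem mainTheorem5 (n : ℕ) : IsHopfian (BraidGroup n) := by
  refine isHopfian_of_exists_monoidHom_ne_one fun b hb => ?_
  obtain ⟨X, _, f, hf⟩ := BraidGroup.exists_finite_monoidHom_ne_one b hb
  refine ⟨Equiv.Perm X, inferInstance, ?_, f, hf⟩
  -- Finite generation enters here: a homomorphism is determined by its values on the generators.
  exact Finite.of_injective
    (fun (g : BraidGroup n →* Equiv.Perm X) (i : Fin (n - 1)) => g (PresentedGroup.of i))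
    fun g g' h => PresentedGroup.ext (congrFun h)
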